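/- Let $h,g,\sigma>0$ and let $\gamma\in C^{2,1}_{\mathrm{loc}}(\mathbb R)$ with $\|\gamma'\|_\infty<\infty$. For $\lambda\in\mathbb R$ let $\psi^\lambda$ be the unique solution of $$\psi''=-\gamma(\psi)\ \text{ on }[-h,0],\qquad \psi(0)=0,\quad \psi'(0)=\lambda ,$$ and put $p_0=m(\lambda):=-\psi^\lambda(-h)$, $\Gamma(p):=\int_0^p\gamma(-s)\,ds$ and $a(p):=\sqrt{\lambda^2+2\Gamma(p)}$. For $\lambda\neq0$ and $\mu\in\mathbb R$ not in the Dirichlet spectrum of $-\partial_y^2-\gamma'(\psi^\lambda)$ on $[-h,0]$ let $\beta=\beta^{\mu,\lambda}$ be the unique solution of $\beta''+(\gamma'(\psi^\lambda)+\mu)\beta=0$ on $[-h,0]$, $\beta(-h)=0$, $\beta(0)=1$, and set $$d(\mu,\lambda):=\beta_y^{\mu,\lambda}(0)+\sigma\lambda^{-2}\mu+\lambda^{-1}\gamma(0)-\lambda^{-2}g;$$ if $\mu$ is in that Dirichlet spectrum, set $d(\mu,\lambda):=\infty$. Consider also the Sturm–Liouville problem $$(a^3v_p)_p=-\mu a v\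 \text{ on }[p_0,0],\qquad a^3(0)v_p(0)=(-\sigma\mu+g)v(0),\qquad v(p_0)=0. \tag{SL}$$ Assume that there are $0\le\delta<1$ and $C>0$ such that $|\gamma(p)|\le C(|p|^\delta+1)$ for all $p>0$, and let $\lambda<0$. Then: (a) If $|\lambda|$ is sufficiently large, then $p_0<0$ and $\lambda^2>-2\min_{[p_0,0]}\Gamma$. (b) If $p_0<0$ and $\lambda^2>-2\min_{[p_0,0]}\Gamma$, then there are at most two $\mu<0$ such that (SL) has a nontrivial solution. If, moreover, $\psi^\lambda$ is strictly decreasing on $[-h,0]$, then for every $\mu<0$ the problem (SL) has a nontrivial solution if and only if $d(\mu,\lambda)=0$; in particular there are at most two $\mu<0$ with $d(\mu,\lambda)=0$. (c) If $|\lambda|$ is sufficiently large, there is exactly one $\mu_0<0$ such that (SL) with $\mu=\mu_0$ has a nontrivial solution, and this $\mu_0$ is also the only $\mu<0$ with $d(\mu,\lambda)=0$. For such $\lambda$, if an integer $k_0\ge1$ and $\nu>0$ are such that $-(k_0\nu)^2=\mu_0$, then $k=k_0$ is the only integer $k\ge1$ satisfying the dispersion relation $d(-(k\nu)^2,\lambda)=0$.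 -/

import Mathlib

open Set

noncomputable section

namespace WaterWave

/-- The standing regularity of the vorticity function: `γ` is of class `C^{2,1}_loc` on the real
line and `γ'` is bounded. -/
structure IsVorticity (γ : ℝ → ℝ) : Prop where
  contDiff : ContDiff ℝ 2 γ
  locLip : LocallyLipschitz (iteratedDeriv 2 γ)
  bddDeriv : ∃ M : ℝ, ∀ x, |deriv γ x| ≤ M

/-- On the interval `I`, `u` is twice differentiable (one-sidedly at end points that belong
to `I`) with first derivative `u'` and second derivative `u''`. -/
structure HasTwoDerivsOn (I : Set ℝ) (u u' u'' : ℝ → ℝ) : Prop where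
  first : ∀ y ∈ I, HasDerivWithinAt u (u' y) I y
  second : ∀ y ∈ I, HasDerivWithinAt u' (u'' y) I y

/-- The Cauchy problem `ψ'' = -γ(ψ)` on `[-h, 0]`, `ψ(0) = 0`, `ψ'(0) = lam`. -/
def IsTrivialSol (γ : ℝ → ℝ) (h lam : ℝ) (ψ : ℝ → ℝ) : Prop :=
  ∃ ψ' : ℝ → ℝ, HasTwoDerivsOn (Icc (-h) 0) ψ ψ' (fun y => -γ (ψ y)) ∧ ψ 0 = 0 ∧ ψ' 0 = lam

open Classical in
/-- The trivial stream function `ψ^lam`: the solution of the Cauchy problem. For `h > 0` and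
globally Lipschitz `γ` it exists, and it is unique on `[-h, 0]`; only its values on that interval
are ever used. -/
def trivialSol (γ : ℝ → ℝ) (h lam : ℝ) : ℝ → ℝ :=
  if H : ∃ ψ, IsTrivialSol γ h lam ψ then H.choose else 0

/-- The relative mass flux `m(lam) = -ψ^lam(-h)`. -/
def massFlux (γ : ℝ → ℝ) (h lam : ℝ) : ℝ := -trivialSol γ h lam (-h)

/-- `u'' + (γ'(ψ^lam) + μ) u = 0` on `[-h, 0]`. -/
def SolvesLinearized (γ : ℝ → ℝ) (h lam μ : ℝ) (u : ℝ → ℝ) : Prop :=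
  ∃ u' : ℝ → ℝ, HasTwoDerivsOn (Icc (-h) 0) u u'
    (fun y => -((deriv γ (trivialSol γ h lam y) + μ) * u y))

/-- `μ` is in the Dirichlet spectrum of `-∂_y² - γ'(ψ^lam)` on `[-h, 0]`. -/
def InDirichletSpectrum (γ : ℝ → ℝ) (h lam μ : ℝ) : Prop :=
  ∃ u : ℝ → ℝ, SolvesLinearized γ h lam μ u ∧ u (-h) = 0 ∧ u 0 = 0 ∧ ∃ y ∈ Icc (-h) 0, u y ≠ 0

/-- `β'' + (γ'(ψ^lam) + μ) β = 0` on `[-h, 0]`, `β(-h) = 0`, `β(0) = 1`. -/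
def IsBeta (γ : ℝ → ℝ) (h lam μ : ℝ) (β : ℝ → ℝ) : Prop :=
  SolvesLinearized γ h lam μ β ∧ β (-h) = 0 ∧ β 0 = 1

open Classical in
/-- The solution `β^{μ,lam}` of this boundary value problem; it exists, and is unique on `[-h, 0]`,
whenever `μ` is not in the Dirichlet spectrum. -/
def beta (γ : ℝ → ℝ) (h lam μ : ℝ) : ℝ → ℝ :=
  if H : ∃ β, IsBeta γ h lam μ β then H.choose else 0

open Classical in
/-- The dispersion function
`d(μ,lam) = β_y^{μ,lam}(0) + σ μ / lam² + γ(0) / lam - g / lam²`, and `d(μ,lam) = ∞` if `μ` is in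
the Dirichlet spectrum of `-∂_y² - γ'(ψ^lam)` on `[-h, 0]`. -/
def dispersion (γ : ℝ → ℝ) (h g σ μ lam : ℝ) : EReal :=
  if InDirichletSpectrum γ h lam μ then ⊤
  else ((derivWithin (beta γ h lam μ) (Icc (-h) 0) 0
    + σ * μ / lam ^ 2 + γ 0 / lam - g / lam ^ 2 : ℝ) : EReal)

/-- `Γ(p) = ∫₀^p γ(-s) ds`. -/
def Gam (γ : ℝ → ℝ) (p : ℝ) : ℝ := ∫ s in (0 : ℝ)..p, γ (-s)

/-- `a(p) = √(lam² + 2 Γ(p))`. -/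
def aCoeff (γ : ℝ → ℝ) (lam p : ℝ) : ℝ := Real.sqrt (lam ^ 2 + 2 * Gam γ p)

/-- The condition `lam² > -2 min_{[p₀,0]} Γ`, where `p₀ = m(lam)`. For `p₀ ≤ 0` the infimum below
is attained. -/
def GammaCondition (γ : ℝ → ℝ) (h lam : ℝ) : Prop :=
  lam ^ 2 > -2 * sInf (Gam γ '' Icc (massFlux γ h lam) 0)

/-- The Sturm-Liouville problem `(a³ v')' = -μ a v` on `[p₀, 0]`,
`a(0)³ v'(0) = (-σ μ + g) v(0)`, `v(p₀) = 0`, with `p₀ = m(lam)`, has a nontrivial solution. -/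
def HasNontrivialSL (γ : ℝ → ℝ) (h g σ μ lam : ℝ) : Prop :=
  ∃ v v' : ℝ → ℝ,
    (∀ p ∈ Icc (massFlux γ h lam) 0,
      HasDerivWithinAt v (v' p) (Icc (massFlux γ h lam) 0) p) ∧
    (∀ p ∈ Icc (massFlux γ h lam) 0,
      HasDerivWithinAt (fun q => aCoeff γ lam q ^ 3 * v' q) (-μ * aCoeff γ lam p * v p)
        (Icc (massFlux γ h lam) 0) p) ∧
    aCoeff γ lam 0 ^ 3 * v' 0 = (-σ * μ + g) * v 0 ∧
    v (massFlux γ h lam) = 0 ∧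
    ∃ p ∈ Icc (massFlux γ h lam) 0, v p ≠ 0

end WaterWave

end

/-! With s = -μ > 0, positivity of `a` lets every solution of (SL) be normalized to value 1 at p =
0. The normalized solution minimizes ∫ a³ w'² + s ∫ a w² among test functions with boundary values 0
and 1, and the minimum is its surface flux f(s) = a(0)³ v'(0). Thus (SL) is solvable exactly when
f(s) = g + σ s. As a minimum of affine functions of s, f is concave, strictly so because different s
have different minimizers (`exists_fluxFunction`). A line meets it at most twice
(`encard_le_two_of_tangent`).

If ψ' < 0, the semi-hodograph variable p = -ψ(y) satisfies a(p) = -ψ'(y), and β(y) = (ψ'(y)/λ)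
v(-ψ(y)). This yields d = (f(s) - g - σ s)/λ² (`IsNormalizedSL.dispersion_eq`), so the two problems
have the same negative roots.

For large |λ|, sublinear growth of γ keeps ψ' between 3λ/2 and λ/2 (`slope_bounds`). Then a ≥ |λ|/2
and |p₀| ≤ 3|λ|h/2, so f stays above a constant of order λ²/h, which exceeds g: f starts above the
line. Test functions concentrated at the surface bound f by an affine function of slope less than σ:
f ends below the line. Concavity leaves exactly one crossing (`existsUnique_of_tangent`). -/

namespace WaterWave

/-! ### Global existence for Lipschitz planar systems -/

/-- The truncation of a real number to `[-R, R]`. -/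
def clamp (R x : ℝ) : ℝ := max (-R) (min R x)

lemma lipschitzWith_clamp (R : ℝ) : LipschitzWith 1 (clamp R) :=
  (LipschitzWith.id.const_min R).const_max (-R)

lemma abs_clamp_le {R : ℝ} (hR : 0 ≤ R) (x : ℝ) : |clamp R x| ≤ R := by
  unfold clamp
  rw [abs_le]
  exact ⟨le_max_left _ _, max_le (by linarith) (min_le_left _ _)⟩

lemma abs_clamp_le_abs {R : ℝ} (hR : 0 ≤ R) (x : ℝ) : |clamp R x| ≤ |x| := by
  unfold clamp
  rw [abs_le]
  constructor
  · rcases le_total R x with hx | hx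
    · rw [min_eq_left hx]
      exact le_max_of_le_right (by linarith [abs_nonneg x])
    · rw [min_eq_right hx]
      exact le_max_of_le_right (neg_abs_le x)
  · exact max_le (by linarith [abs_nonneg x]) ((min_le_right _ _).trans (le_abs_self x))

lemma clamp_of_abs_le {R x : ℝ} (hx : |x| ≤ R) : clamp R x = x := by
  unfold clamp
  rw [abs_le] at hx
  rw [min_eq_right hx.2, max_eq_right hx.1]

lemma hasDerivWithinAt_components {x : ℝ → ℝ × ℝ} {x' : ℝ × ℝ} {t : ℝ} {s : Set ℝ}
    (hx : HasDerivWithinAt x x' s t) :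
    HasDerivWithinAt (fun q => (x q).1) x'.1 s t ∧ HasDerivWithinAt (fun q => (x q).2) x'.2 s t :=
  ⟨(hasFDerivAt_fst (𝕜 := ℝ) (p := x t)).comp_hasDerivWithinAt t hx,
    (hasFDerivAt_snd (𝕜 := ℝ) (p := x t)).comp_hasDerivWithinAt t hx⟩

/-- A continuous planar vector field that is globally Lipschitz in space has solutions on every
compact time interval. -/
theorem exists_solution_of_lipschitz {f : ℝ → ℝ × ℝ → ℝ × ℝ} {a b : ℝ} (hab : a ≤ b) {K : NNReal}
    (hlip : ∀ t ∈ Icc a b, LipschitzWith K (f t))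
    (hcont : ∀ x, ContinuousOn (fun t => f t x) (Icc a b)) (x₀ : ℝ × ℝ) :
    ∃ x : ℝ → ℝ × ℝ, x a = x₀ ∧ ∀ t ∈ Icc a b, HasDerivWithinAt x (f t (x t)) (Icc a b) t := by
  obtain ⟨c, hc⟩ := isCompact_Icc.exists_bound_of_continuousOn (hcont 0)
  have hc0 : 0 ≤ c := (norm_nonneg _).trans (hc a (left_mem_Icc.2 hab))
  have hgrow : ∀ t ∈ Icc a b, ∀ x, ‖f t x‖ ≤ K * ‖x‖ + c := fun t ht x => by
    have h1 := (hlip t ht).dist_le_mul x 0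
    rw [dist_eq_norm, dist_zero_right] at h1
    have h2 := norm_le_norm_add_norm_sub' (f t x) (f t 0)
    linarith [hc t ht]
  -- A priori bound for any solution. Truncating the field at radius R makes it bounded without
  -- affecting the solution.
  set R : ℝ := gronwallBound ‖x₀‖ K c (b - a) with hRdef
  have hR : ∀ t ∈ Icc a b, gronwallBound ‖x₀‖ K c (t - a) ≤ R := fun t ht =>
    gronwallBound_mono (norm_nonneg _) hc0 K.2 (by linarith [ht.2])
  have hR0 : 0 ≤ R := by
    have := hR a (left_mem_Icc.2 hab)
    rw [sub_self, gronwallBound_x0] at this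
    exact (norm_nonneg _).trans this
  set ρ : ℝ × ℝ → ℝ × ℝ := fun x => (clamp R x.1, clamp R x.2) with hρ
  have hρlip : LipschitzWith 1 ρ := by
    have h1 := (lipschitzWith_clamp R).comp (LipschitzWith.prod_fst (α := ℝ) (β := ℝ))
    have h2 := (lipschitzWith_clamp R).comp (LipschitzWith.prod_snd (α := ℝ) (β := ℝ))
    simpa using h1.prodMk h2
  have hρR : ∀ x, ‖ρ x‖ ≤ R := fun x =>
    max_le (abs_clamp_le hR0 _) (abs_clamp_le hR0 _)
  have hρx : ∀ x, ‖ρ x‖ ≤ ‖x‖ := fun x =>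
    max_le_max (abs_clamp_le_abs hR0 _) (abs_clamp_le_abs hR0 _)
  have hρid : ∀ x, ‖x‖ ≤ R → ρ x = x := fun x hx =>
    Prod.ext (clamp_of_abs_le ((le_max_left _ _).trans hx))
      (clamp_of_abs_le ((le_max_right _ _).trans hx))
  have hL : 0 ≤ K * R + c := by positivity
  have hA : 0 ≤ (K * R + c) * (b - a) := mul_nonneg hL (by linarith)
  -- The truncated field has norm at most K R + c, so a ball of radius (K R + c)(b - a) serves the
  -- whole interval at once.
  have hPL : IsPicardLindelof (fun t x => f t (ρ x)) (tmin := a) (tmax := b)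
      ⟨a, left_mem_Icc.2 hab⟩ x₀ ⟨(K * R + c) * (b - a), hA⟩ 0 ⟨K * R + c, hL⟩ K := by
    refine ⟨fun t ht => ?_, fun x _ => hcont (ρ x), fun t ht x _ => ?_, ?_⟩
    · have := (hlip t ht).comp hρlip
      rw [mul_one] at this
      exact this.lipschitzOnWith
    · refine (hgrow t ht _).trans ?_
      change (K : ℝ) * ‖ρ x‖ + c ≤ K * R + c
      gcongr
      exact hρR x
    · change (K * R + c) * max (b - a) (a - a) ≤ (K * R + c) * (b - a) - 0
      rw [sub_self, max_eq_left (by linarith), sub_zero]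
  obtain ⟨x, hx0, hx⟩ := hPL.exists_eq_forall_mem_Icc_hasDerivWithinAt₀
  change x a = x₀ at hx0
  have hbound : ∀ t ∈ Icc a b, ‖x t‖ ≤ gronwallBound ‖x₀‖ K c (t - a) := by
    refine norm_le_gronwallBound_of_norm_deriv_right_le
      (fun t ht => (hx t ht).continuousWithinAt)
      (fun t ht => (hx t (Ico_subset_Icc_self ht)).mono_of_mem_nhdsWithin
        (Icc_mem_nhdsGE_of_mem ht)) (by rw [hx0]) fun t ht => ?_
    refine (hgrow t (Ico_subset_Icc_self ht) _).trans ?_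
    gcongr
    exact hρx _
  refine ⟨x, hx0, fun t ht => ?_⟩
  have := hx t ht
  rwa [hρid _ ((hbound t ht).trans (hR t ht))] at this

/-! ### One-sided calculus and uniqueness for the Dirichlet problem -/

/-- A function with vanishing one-sided derivative on a compact interval is constant. -/
lemma eq_left_of_hasDerivWithinAt_zero {z : ℝ → ℝ} {l r : ℝ}
    (hz : ∀ x ∈ Icc l r, HasDerivWithinAt z 0 (Icc l r) x) : ∀ x ∈ Icc l r, z x = z l :=
  constant_of_has_deriv_right_zero (fun x hx => (hz x hx).continuousWithinAt)
    fun x hx => (hz x (Ico_subset_Icc_self hx)).mono_of_mem_nhdsWithin (Icc_mem_nhdsGE_of_mem hx)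

/-- A function with nonnegative one-sided derivative on a compact interval is monotone there. -/
lemma monotoneOn_Icc_of_hasDerivWithinAt {z z' : ℝ → ℝ} {l r : ℝ}
    (hz : ∀ x ∈ Icc l r, HasDerivWithinAt z (z' x) (Icc l r) x)
    (hz' : ∀ x ∈ Icc l r, 0 ≤ z' x) : MonotoneOn z (Icc l r) :=
  monotoneOn_of_hasDerivWithinAt_nonneg (convex_Icc l r)
    (fun x hx => (hz x hx).continuousWithinAt)
    (fun x hx => (hz x (interior_subset hx)).mono interior_subset)
    (fun x hx => hz' x (interior_subset hx))

/-- A solution of `(P z')' = Q z` with `P > 0`, `Q ≥ 0` that vanishes at both end points of an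
interval vanishes identically. -/
lemma eq_zero_of_dirichlet {z Z P Q : ℝ → ℝ} {l r : ℝ} (hlr : l < r)
    (hz : ∀ x ∈ Icc l r, HasDerivWithinAt z (Z x / P x) (Icc l r) x)
    (hZ : ∀ x ∈ Icc l r, HasDerivWithinAt Z (Q x * z x) (Icc l r) x)
    (hP : ∀ x ∈ Icc l r, 0 < P x) (hQ : ∀ x ∈ Icc l r, 0 ≤ Q x)
    (hl : z l = 0) (hr : z r = 0) : ∀ x ∈ Icc l r, z x = 0 ∧ Z x = 0 := by
  -- The product z Z has derivative Z²/P + Q z² ≥ 0 and vanishes at both ends, so it is identically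
  -- zero, and hence so is Z.
  have hd : ∀ x ∈ Icc l r, HasDerivWithinAt (fun y => z y * Z y)
      (Z x / P x * Z x + z x * (Q x * z x)) (Icc l r) x := fun x hx => (hz x hx).mul (hZ x hx)
  have hnn1 : ∀ x ∈ Icc l r, 0 ≤ Z x / P x * Z x := fun x hx => by
    rw [div_mul_eq_mul_div]
    exact div_nonneg (mul_self_nonneg _) (hP x hx).le
  have hnn2 : ∀ x ∈ Icc l r, 0 ≤ z x * (Q x * z x) := fun x hx => by
    nlinarith [mul_nonneg (hQ x hx) (mul_self_nonneg (z x))]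
  have hmono := monotoneOn_Icc_of_hasDerivWithinAt hd
    (fun x hx => add_nonneg (hnn1 x hx) (hnn2 x hx))
  have hconst : ∀ x ∈ Icc l r, z x * Z x = 0 := fun x hx => by
    have h1 := hmono (left_mem_Icc.2 hlr.le) hx hx.1
    have h2 := hmono hx (right_mem_Icc.2 hlr.le) hx.2
    simp only [hl, hr, zero_mul] at h1 h2
    exact le_antisymm h2 h1
  have hZ0 : ∀ x ∈ Icc l r, Z x = 0 := fun x hx => by
    have h0 : HasDerivWithinAt (fun y => z y * Z y) 0 (Icc l r) x :=
      (hasDerivWithinAt_const x (Icc l r) (0 : ℝ)).congr hconst (hconst x hx)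
    have h1 := (uniqueDiffOn_Icc hlr x hx).eq_deriv _ (hd x hx) h0
    have h2 : Z x / P x * Z x = 0 := le_antisymm (by linarith [hnn2 x hx]) (hnn1 x hx)
    rw [div_mul_eq_mul_div, div_eq_zero_iff] at h2
    exact mul_self_eq_zero.1 (h2.resolve_right (hP x hx).ne')
  have hz0 := eq_left_of_hasDerivWithinAt_zero (z := z) (l := l) (r := r) fun x hx => by
    simpa [hZ0 x hx] using hz x hx
  exact fun x hx => ⟨(hz0 x hx).trans hl, hZ0 x hx⟩

/-! ### Variational characterization of the flux -/

/-- `v` solves `(a³ v')' = s a v` on `[l, r]` with `v(l) = 0`, `v(r) = 1`. -/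
structure IsNormalizedSL (a : ℝ → ℝ) (l r s : ℝ) (v v' : ℝ → ℝ) : Prop where
  first : ∀ p ∈ Icc l r, HasDerivWithinAt v (v' p) (Icc l r) p
  second : ∀ p ∈ Icc l r,
    HasDerivWithinAt (fun q => a q ^ 3 * v' q) (s * a p * v p) (Icc l r) p
  left : v l = 0
  right : v r = 1

/-- `w` is continuously differentiable on `[l, r]` with `w(l) = 0`, `w(r) = 1`. -/
structure IsTestFunction (l r : ℝ) (w w' : ℝ → ℝ) : Prop where
  first : ∀ p ∈ Icc l r, HasDerivWithinAt w (w' p) (Icc l r) p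
  cont : ContinuousOn w' (Icc l r)
  left : w l = 0
  right : w r = 1

lemma IsTestFunction.continuousOn {l r : ℝ} {w w' : ℝ → ℝ} (hw : IsTestFunction l r w w') :
    ContinuousOn w (Icc l r) := fun p hp => (hw.first p hp).continuousWithinAt

/-- The Dirichlet energy `∫ a³ w'²`. -/
noncomputable def dirichletEnergy (a : ℝ → ℝ) (l r : ℝ) (w' : ℝ → ℝ) : ℝ :=
  ∫ p in l..r, a p ^ 3 * w' p ^ 2

/-- The weighted mass `∫ a w²`. -/
noncomputable def weightedMass (a : ℝ → ℝ) (l r : ℝ) (w : ℝ → ℝ) : ℝ := ∫ p in l..r, a p * w p ^ 2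

section SturmLiouville

variable {a : ℝ → ℝ} {l r s : ℝ} {v v' w w' : ℝ → ℝ}

/-- Continuity of v' is recovered by dividing the differentiable flux a³ v' by a³ > 0. Solutions can
therefore compete in each other's minimization problems. -/
lemma IsNormalizedSL.isTestFunction (ha : ContinuousOn a (Icc l r)) (hpos : ∀ p ∈ Icc l r, 0 < a p)
    (hv : IsNormalizedSL a l r s v v') : IsTestFunction l r v v' where
  first := hv.first
  cont := by
    have h1 : ContinuousOn (fun q => a q ^ 3 * v' q) (Icc l r) :=
      fun p hp => (hv.second p hp).continuousWithinAt
    refine (h1.div (ha.pow 3) fun p hp => (pow_pos (hpos p hp) 3).ne').congr fun p hp => ?_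
    have := (hpos p hp).ne'
    simp only [Pi.div_apply, Pi.pow_apply]
    field_simp
  left := hv.left
  right := hv.right

/-- Green's formula for a solution tested against a test function. -/
lemma IsNormalizedSL.green (hlr : l < r) (ha : ContinuousOn a (Icc l r))
    (hpos : ∀ p ∈ Icc l r, 0 < a p) (hv : IsNormalizedSL a l r s v v')
    (hw : IsTestFunction l r w w') :
    ∫ p in l..r, (s * a p * v p * w p + a p ^ 3 * v' p * w' p) = a r ^ 3 * v' r := by
  have ht := hv.isTestFunction ha hpos
  have hd : ∀ p ∈ Icc l r, HasDerivWithinAt (fun q => a q ^ 3 * v' q * w q)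
      (s * a p * v p * w p + a p ^ 3 * v' p * w' p) (Icc l r) p :=
    fun p hp => (hv.second p hp).mul (hw.first p hp)
  have hc : ContinuousOn (fun p => s * a p * v p * w p + a p ^ 3 * v' p * w' p) (Icc l r) :=
    (((continuousOn_const.mul ha).mul ht.continuousOn).mul hw.continuousOn).add
      (((ha.pow 3).mul ht.cont).mul hw.cont)
  rw [intervalIntegral.integral_eq_sub_of_hasDerivAt_of_le hlr.le
    (fun p hp => (hd p hp).continuousWithinAt)
    (fun p hp => (hd p (Ioo_subset_Icc_self hp)).hasDerivAt (Icc_mem_nhds hp.1 hp.2))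
    (hc.intervalIntegrable_of_Icc hlr.le), hw.left, hw.right]
  ring

lemma IsTestFunction.intervalIntegrable (hlr : l < r) (ha : ContinuousOn a (Icc l r))
    (hw : IsTestFunction l r w w') :
    IntervalIntegrable (fun p => a p ^ 3 * w' p ^ 2) MeasureTheory.volume l r ∧
    IntervalIntegrable (fun p => a p * w p ^ 2) MeasureTheory.volume l r :=
  ⟨((ha.pow 3).mul (hw.cont.pow 2)).intervalIntegrable_of_Icc hlr.le,
    (ha.mul (hw.continuousOn.pow 2)).intervalIntegrable_of_Icc hlr.le⟩

/-- The flux of a normalized solution is its energy. -/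
lemma IsNormalizedSL.flux_eq_energy (hlr : l < r) (ha : ContinuousOn a (Icc l r))
    (hpos : ∀ p ∈ Icc l r, 0 < a p) (hv : IsNormalizedSL a l r s v v') :
    a r ^ 3 * v' r = dirichletEnergy a l r v' + s * weightedMass a l r v := by
  have ht := hv.isTestFunction ha hpos
  obtain ⟨i1, i2⟩ := ht.intervalIntegrable hlr ha
  rw [← hv.green hlr ha hpos ht, dirichletEnergy, weightedMass,
    ← intervalIntegral.integral_const_mul, ← intervalIntegral.integral_add i1 (i2.const_mul s)]
  exact intervalIntegral.integral_congr fun p _ => by ring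

/-- The energy of a test function exceeds the flux of the normalized solution by the energy of
their difference. -/
lemma IsNormalizedSL.energy_sub_flux (hlr : l < r) (ha : ContinuousOn a (Icc l r))
    (hpos : ∀ p ∈ Icc l r, 0 < a p) (hv : IsNormalizedSL a l r s v v')
    (hw : IsTestFunction l r w w') :
    dirichletEnergy a l r w' + s * weightedMass a l r w - a r ^ 3 * v' r =
      ∫ p in l..r, (a p ^ 3 * (w' p - v' p) ^ 2 + s * (a p * (w p - v p) ^ 2)) := by
  have ht := hv.isTestFunction ha hpos
  obtain ⟨i1, i2⟩ := hw.intervalIntegrable hlr ha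
  obtain ⟨j1, j2⟩ := ht.intervalIntegrable hlr ha
  have g1 := hv.green hlr ha hpos hw
  have g2 := hv.flux_eq_energy hlr ha hpos
  have k : IntervalIntegrable (fun p => s * a p * v p * w p + a p ^ 3 * v' p * w' p)
      MeasureTheory.volume l r :=
    ((((continuousOn_const.mul ha).mul ht.continuousOn).mul hw.continuousOn).add
      (((ha.pow 3).mul ht.cont).mul hw.cont)).intervalIntegrable_of_Icc hlr.le
  -- Expansion of the quadratic form at w - v. By Green's formula the cross term is the flux,
  -- whatever the test function w.
  have e : dirichletEnergy a l r w' + s * weightedMass a l r w +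
      (dirichletEnergy a l r v' + s * weightedMass a l r v) - 2 * (a r ^ 3 * v' r) =
      ∫ p in l..r, (a p ^ 3 * (w' p - v' p) ^ 2 + s * (a p * (w p - v p) ^ 2)) := by
    rw [← g1, dirichletEnergy, weightedMass, dirichletEnergy, weightedMass,
      ← intervalIntegral.integral_const_mul, ← intervalIntegral.integral_const_mul,
      ← intervalIntegral.integral_const_mul,
      ← intervalIntegral.integral_add i1 (i2.const_mul s),
      ← intervalIntegral.integral_add j1 (j2.const_mul s),
      ← intervalIntegral.integral_add (i1.add (i2.const_mul s)) (j1.add (j2.const_mul s)),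
      ← intervalIntegral.integral_sub ((i1.add (i2.const_mul s)).add (j1.add (j2.const_mul s)))
        (k.const_mul 2)]
    exact intervalIntegral.integral_congr fun p _ => by ring
  linarith

/-- The normalized solution minimizes the energy. -/
lemma IsNormalizedSL.flux_le_energy (hlr : l < r) (ha : ContinuousOn a (Icc l r))
    (hpos : ∀ p ∈ Icc l r, 0 < a p) (hs : 0 ≤ s) (hv : IsNormalizedSL a l r s v v')
    (hw : IsTestFunction l r w w') :
    a r ^ 3 * v' r ≤ dirichletEnergy a l r w' + s * weightedMass a l r w := by
  have h1 := hv.energy_sub_flux hlr ha hpos hw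
  have h2 : 0 ≤ ∫ p in l..r, (a p ^ 3 * (w' p - v' p) ^ 2 + s * (a p * (w p - v p) ^ 2)) :=
    intervalIntegral.integral_nonneg hlr.le fun p hp => by
      have := hpos p hp
      positivity
  linarith

/-- A test function that differs from the normalized solution has strictly larger energy. -/
lemma IsNormalizedSL.flux_lt_energy (hlr : l < r) (ha : ContinuousOn a (Icc l r))
    (hpos : ∀ p ∈ Icc l r, 0 < a p) (hs : 0 < s) (hv : IsNormalizedSL a l r s v v')
    (hw : IsTestFunction l r w w') (hne : ∃ p ∈ Icc l r, w p ≠ v p) :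
    a r ^ 3 * v' r < dirichletEnergy a l r w' + s * weightedMass a l r w := by
  have ht := hv.isTestFunction ha hpos
  have h1 := hv.energy_sub_flux hlr ha hpos hw
  have h2 : 0 < ∫ p in l..r, (a p ^ 3 * (w' p - v' p) ^ 2 + s * (a p * (w p - v p) ^ 2)) := by
    refine intervalIntegral.integral_pos hlr
      (((ha.pow 3).mul ((hw.cont.sub ht.cont).pow 2)).add
        (continuousOn_const.mul (ha.mul ((hw.continuousOn.sub ht.continuousOn).pow 2))))
      (fun p hp => ?_) ?_
    · have := hpos p (Ioc_subset_Icc_self hp)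
      positivity
    · obtain ⟨p, hp, hpn⟩ := hne
      refine ⟨p, hp, ?_⟩
      have h3 := hpos p hp
      have h4 : 0 < (w p - v p) ^ 2 := by
        have := sub_ne_zero.2 hpn
        positivity
      positivity
  linarith

/-- Normalized solutions exist. -/
lemma exists_isNormalizedSL (hlr : l < r) (ha : ContinuousOn a (Icc l r))
    (hpos : ∀ p ∈ Icc l r, 0 < a p) (hs : 0 ≤ s) : ∃ v v', IsNormalizedSL a l r s v v' := by
  have hc1 : ContinuousOn (fun p => (a p ^ 3)⁻¹) (Icc l r) :=
    (ha.pow 3).inv₀ fun p hp => (pow_pos (hpos p hp) 3).ne'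
  have hc2 : ContinuousOn (fun p => s * a p) (Icc l r) := continuousOn_const.mul ha
  obtain ⟨c₁, hb1⟩ := isCompact_Icc.exists_bound_of_continuousOn hc1
  obtain ⟨c₂, hb2⟩ := isCompact_Icc.exists_bound_of_continuousOn hc2
  -- Shooting from l with (v, a³ v') = (0, 1). Using the flux as second unknown requires only
  -- continuity of a.
  obtain ⟨x, hx0, hx⟩ := exists_solution_of_lipschitz
    (f := fun t x => ((a t ^ 3)⁻¹ * x.2, s * a t * x.1)) hlr.le (K := (max c₁ c₂).toNNReal)
    (fun t ht => by
      refine LipschitzWith.of_dist_le_mul fun x y => ?_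
      have hK : (max c₁ c₂) ≤ ((max c₁ c₂).toNNReal : ℝ) := Real.le_coe_toNNReal _
      rw [Prod.dist_eq]
      simp only [Real.dist_eq, ← mul_sub, abs_mul]
      refine max_le ?_ ?_
      · refine mul_le_mul ?_ ?_ (abs_nonneg _) (NNReal.coe_nonneg _)
        · exact ((hb1 t ht).trans (le_max_left _ _)).trans hK
        · rw [Prod.dist_eq, ← Real.dist_eq]
          exact le_max_right _ _
      · rw [← abs_mul s]
        refine mul_le_mul ?_ ?_ (abs_nonneg _) (NNReal.coe_nonneg _)
        · exact ((hb2 t ht).trans (le_max_right _ _)).trans hK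
        · rw [Prod.dist_eq, ← Real.dist_eq]
          exact le_max_left _ _)
    (fun x => (hc1.mul continuousOn_const).prodMk (hc2.mul continuousOn_const)) (0, 1)
  have h1 : ∀ p ∈ Icc l r,
      HasDerivWithinAt (fun q => (x q).1) ((x p).2 / a p ^ 3) (Icc l r) p := fun p hp => by
    rw [div_eq_inv_mul]
    exact (hasDerivWithinAt_components (hx p hp)).1
  have h2 : ∀ p ∈ Icc l r,
      HasDerivWithinAt (fun q => (x q).2) (s * a p * (x p).1) (Icc l r) p := fun p hp =>
    (hasDerivWithinAt_components (hx p hp)).2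
  have hl0 : (x l).1 = 0 := by rw [hx0]
  have hne : (x r).1 ≠ 0 := fun h0 => by
    have := (eq_zero_of_dirichlet hlr h1 h2 (fun p hp => pow_pos (hpos p hp) 3)
      (fun p hp => mul_nonneg hs (hpos p hp).le) hl0 h0 l (left_mem_Icc.2 hlr.le)).2
    rw [hx0] at this
    exact one_ne_zero this
  refine ⟨fun p => (x p).1 / (x r).1, fun p => (x p).2 / a p ^ 3 / (x r).1,
    fun p hp => (h1 p hp).div_const _, fun p hp => ?_, by simp [hl0], div_self hne⟩
  have h3 := (h2 p hp).div_const (x r).1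
  have h4 : ∀ q ∈ Icc l r, a q ^ 3 * ((x q).2 / a q ^ 3 / (x r).1) = (x q).2 / (x r).1 :=
    fun q hq => by
      have := (hpos q hq).ne'
      field_simp
  rw [mul_div_assoc] at h3
  exact h3.congr h4 (h4 p hp)

/-- Normalized solutions for different parameters differ. -/
lemma IsNormalizedSL.exists_ne {t : ℝ} (hlr : l < r) (hpos : ∀ p ∈ Icc l r, 0 < a p)
    (hst : s ≠ t) (hv : IsNormalizedSL a l r s v v') (hw : IsNormalizedSL a l r t w w') :
    ∃ p ∈ Icc l r, v p ≠ w p := by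
  by_contra! H
  have hr := right_mem_Icc.2 hlr.le
  have hd : ∀ p ∈ Icc l r, v' p = w' p := fun p hp =>
    (uniqueDiffOn_Icc hlr p hp).eq_deriv _ (hv.first p hp) ((hw.first p hp).congr H (H p hp))
  have h1 := (uniqueDiffOn_Icc hlr r hr).eq_deriv _ (hv.second r hr)
    ((hw.second r hr).congr (fun p hp => by rw [hd p hp]) (by rw [hd r hr]))
  -- The flux derivatives at r, where both solutions equal 1, are s a(r) and t a(r).
  rw [hv.right, hw.right, mul_one, mul_one] at h1
  exact hst (mul_right_cancel₀ (hpos r hr).ne' h1)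

/-- A lower bound for the energy of test functions. -/
lemma IsTestFunction.le_dirichletEnergy {α : ℝ} (hlr : l < r) (ha : ContinuousOn a (Icc l r))
    (hα : 0 ≤ α) (hle : ∀ p ∈ Icc l r, α ≤ a p) (hw : IsTestFunction l r w w') :
    α ^ 3 / (r - l) ≤ dirichletEnergy a l r w' := by
  have hpos : 0 < r - l := sub_pos.2 hlr
  -- Slope of the linear interpolant. The bound w'² ≥ 2 k w' - k² has a right side whose integral
  -- depends only on the boundary values.
  set k := 1 / (r - l) with hk
  have hc : ContinuousOn (fun p => α ^ 3 * (2 * k * w' p - k ^ 2)) (Icc l r) :=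
    continuousOn_const.mul ((continuousOn_const.mul hw.cont).sub continuousOn_const)
  have hint : ∫ p in l..r, w' p = 1 := by
    rw [intervalIntegral.integral_eq_sub_of_hasDerivAt_of_le hlr.le hw.continuousOn
      (fun p hp => (hw.first p (Ioo_subset_Icc_self hp)).hasDerivAt (Icc_mem_nhds hp.1 hp.2))
      (hw.cont.intervalIntegrable_of_Icc hlr.le), hw.left, hw.right, sub_zero]
  have h1 : ∫ p in l..r, α ^ 3 * (2 * k * w' p - k ^ 2) = α ^ 3 / (r - l) := by
    rw [intervalIntegral.integral_const_mul, intervalIntegral.integral_sub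
      ((hw.cont.intervalIntegrable_of_Icc hlr.le).const_mul _) intervalIntegrable_const,
      intervalIntegral.integral_const_mul, hint, intervalIntegral.integral_const, hk,
      smul_eq_mul]
    field_simp
    ring
  rw [← h1]
  refine intervalIntegral.integral_mono_on hlr.le (hc.intervalIntegrable_of_Icc hlr.le)
    (hw.intervalIntegrable hlr ha).1 fun p hp => ?_
  calc α ^ 3 * (2 * k * w' p - k ^ 2) ≤ α ^ 3 * w' p ^ 2 := by
        gcongr
        nlinarith [sq_nonneg (w' p - k)]
    _ ≤ a p ^ 3 * w' p ^ 2 := by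
        gcongr
        exact hle p hp

/-- There are test functions of arbitrarily small mass. -/
lemma exists_isTestFunction_weightedMass_lt {ε : ℝ} (hlr : l < r) (ha : ContinuousOn a (Icc l r))
    (hε : 0 < ε) : ∃ w w', IsTestFunction l r w w' ∧ weightedMass a l r w < ε := by
  obtain ⟨c, hc⟩ := isCompact_Icc.exists_bound_of_continuousOn ha
  have hc0 : 0 ≤ c := (norm_nonneg _).trans (hc l (left_mem_Icc.2 hlr.le))
  have hpos : 0 < r - l := sub_pos.2 hlr
  obtain ⟨n, hn⟩ := exists_nat_gt (c * (r - l) / ε)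
  -- High powers concentrate at r: the mass is at most c (r - l)/(2n + 3).
  set w : ℝ → ℝ := fun p => ((p - l) / (r - l)) ^ (n + 1) with hw
  set w' : ℝ → ℝ := fun p => (n + 1 : ℕ) * ((p - l) / (r - l)) ^ n * (1 / (r - l)) with hw'
  have hd : ∀ p, HasDerivAt w (w' p) p := fun p =>
    ((((hasDerivAt_id p).sub_const l).div_const (r - l)).pow (n + 1))
  have ht : IsTestFunction l r w w' :=
    ⟨fun p _ => (hd p).hasDerivWithinAt, by fun_prop, by simp [hw], by
      simp [hw, div_self hpos.ne']⟩
  refine ⟨w, w', ht, ?_⟩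
  have hprim : ∀ p, HasDerivAt
      (fun p => c * (r - l) / (2 * n + 3) * ((p - l) / (r - l)) ^ (2 * n + 3)) (c * w p ^ 2) p :=
    fun p => by
      have := (((((hasDerivAt_id p).sub_const l).div_const (r - l)).pow (2 * n + 3))).const_mul
        (c * (r - l) / (2 * n + 3))
      refine this.congr_deriv ?_
      simp only [id, hw, ← pow_mul, Nat.cast_add, Nat.cast_mul, Nat.cast_ofNat,
        show 2 * n + 3 - 1 = (n + 1) * 2 by omega]
      have : (2 * n + 3 : ℝ) ≠ 0 := by positivity
      field_simp
  have hwc : Continuous fun p => c * w p ^ 2 := by fun_prop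
  have hint : ∫ p in l..r, c * w p ^ 2 = c * (r - l) / (2 * n + 3) := by
    rw [intervalIntegral.integral_eq_sub_of_hasDerivAt (fun p _ => hprim p)
      (hwc.intervalIntegrable _ _)]
    simp [div_self hpos.ne']
  calc weightedMass a l r w ≤ ∫ p in l..r, c * w p ^ 2 :=
        intervalIntegral.integral_mono_on hlr.le (ht.intervalIntegrable hlr ha).2
          (hwc.intervalIntegrable _ _) fun p hp => by
            gcongr
            exact (le_abs_self _).trans (hc p hp)
    _ = c * (r - l) / (2 * n + 3) := hint
    _ < ε := by
        rw [div_lt_iff₀ (by positivity)]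
        rw [div_lt_iff₀ hε] at hn
        nlinarith [(Nat.cast_nonneg n : (0 : ℝ) ≤ n)]

/-- The flux `a(r)³ v'(r)` of the normalized solutions as a function of the parameter: its value,
strict concavity in tangent form, and comparison with test functions. -/
theorem exists_fluxFunction (hlr : l < r) (ha : ContinuousOn a (Icc l r))
    (hpos : ∀ p ∈ Icc l r, 0 < a p) :
    ∃ f N : ℝ → ℝ,
      (∀ s, 0 < s → ∃ v v', IsNormalizedSL a l r s v v' ∧ a r ^ 3 * v' r = f s) ∧
      (∀ s, 0 < s → ∀ v v', IsNormalizedSL a l r s v v' → a r ^ 3 * v' r = f s) ∧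
      (∀ s t, 0 < s → 0 < t → s ≠ t → f t < f s + (t - s) * N s) := by
  choose! v v' hv using fun s (hs : 0 < s) => exists_isNormalizedSL hlr ha hpos hs.le
  -- The energy of v_s at parameter t is f(s) + (t - s) N(s) with N(s) = ∫ a v_s², so testing the
  -- problem for t with v_s gives the tangent inequality.
  refine ⟨fun s => a r ^ 3 * v' s r, fun s => weightedMass a l r (v s),
    fun s hs => ⟨_, _, hv s hs, rfl⟩, fun s hs w w' hw => ?_, fun s t hs ht hst => ?_⟩
  · have h1 := (hv s hs).flux_le_energy hlr ha hpos hs.le (hw.isTestFunction ha hpos)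
    have h2 := hw.flux_le_energy hlr ha hpos hs.le ((hv s hs).isTestFunction ha hpos)
    rw [← hw.flux_eq_energy hlr ha hpos] at h1
    rw [← (hv s hs).flux_eq_energy hlr ha hpos] at h2
    exact le_antisymm h2 h1
  · have h1 := (hv t ht).flux_lt_energy hlr ha hpos ht ((hv s hs).isTestFunction ha hpos)
      ((hv s hs).exists_ne hlr hpos hst (hv t ht))
    have h2 := (hv s hs).flux_eq_energy hlr ha hpos
    simp only
    linarith

end SturmLiouville

/-! ### Intersections of a strictly concave function with a line -/

section Tangent

variable {f N : ℝ → ℝ}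

/-- A strictly concave function agrees with an affine function in at most two points. -/
lemma encard_le_two_of_tangent (hT : ∀ s t, 0 < s → 0 < t → s ≠ t → f t < f s + (t - s) * N s)
    (c m : ℝ) {S : Set ℝ} (hS : ∀ x ∈ S, x < 0 ∧ f (-x) = c + m * (-x)) : S.encard ≤ 2 := by
  have key : ∀ x y z, x ∈ S → y ∈ S → z ∈ S → x < y → y < z → False := by
    intro x y z hx hy hz hxy hyz
    obtain ⟨hx0, hx⟩ := hS x hx
    obtain ⟨hy0, hy⟩ := hS y hy
    obtain ⟨hz0, hz⟩ := hS z hz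
    have h1 := hT (-y) (-x) (by linarith) (by linarith) (by linarith)
    have h2 := hT (-y) (-z) (by linarith) (by linarith) (by linarith)
    rw [hx, hy] at h1
    rw [hz, hy] at h2
    -- The tangent at the middle point would need slope above m from one neighbour and below m from
    -- the other.
    nlinarith
  by_contra! H
  obtain ⟨T, hTS, hT3⟩ := Set.exists_subset_encard_eq (k := 3) (Order.add_one_le_of_lt H)
  obtain ⟨x, y, z, hxy, hxz, hyz, rfl⟩ := Set.encard_eq_three.1 hT3
  have hx : x ∈ S := hTS (by simp)
  have hy : y ∈ S := hTS (by simp)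
  have hz : z ∈ S := hTS (by simp)
  rcases lt_or_gt_of_ne hxy with h1 | h1 <;> rcases lt_or_gt_of_ne hxz with h2 | h2 <;>
    rcases lt_or_gt_of_ne hyz with h3 | h3
  · exact key _ _ _ hx hy hz h1 h3
  · exact key _ _ _ hx hz hy h2 h3
  · linarith
  · exact key _ _ _ hz hx hy h2 h1
  · exact key _ _ _ hy hx hz h1 h2
  · linarith
  · exact key _ _ _ hy hz hx h3 h2
  · exact key _ _ _ hz hy hx h3 h1

/-- A strictly concave function on the positive half line that starts above an affine function and
ends below it agrees with it exactly once. -/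
lemma existsUnique_of_tangent (hT : ∀ s t, 0 < s → 0 < t → s ≠ t → f t < f s + (t - s) * N s)
    {c m A B k : ℝ} (hm : 0 < m) (hk : c < k) (hlow : ∀ s, 0 < s → k ≤ f s)
    (hB : B < m) (hup : ∀ s, 0 < s → f s ≤ A + s * B) :
    ∃ s₀, 0 < s₀ ∧ ∀ s, 0 < s → (f s = c + m * s ↔ s = s₀) := by
  have hT' : ∀ s t, 0 < s → 0 < t → f t ≤ f s + (t - s) * N s := fun s t hs ht => by
    rcases eq_or_ne s t with rfl | hst
    · simp
    · exact (hT s t hs ht hst).le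
  have hcont : ContinuousOn f (Ioi 0) := by
    refine ConcaveOn.continuousOn isOpen_Ioi ⟨convex_Ioi 0, fun x hx y hy p q hp hq hpq => ?_⟩
    have hz : p • x + q • y ∈ Ioi (0 : ℝ) := convex_Ioi 0 hx hy hp hq hpq
    simp only [smul_eq_mul] at hz ⊢
    have h1 := mul_le_mul_of_nonneg_left (hT' _ x hz hx) hp
    have h2 := mul_le_mul_of_nonneg_left (hT' _ y hz hy) hq
    obtain rfl : q = 1 - p := by linarith
    linarith
  -- Up to this abscissa the line is at most (c + k)/2 < k ≤ f.
  have hδ : 0 < (k - c) / (2 * m) := div_pos (by linarith) (by linarith)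
  have hsmall : ∀ s, 0 < s → s ≤ (k - c) / (2 * m) → c + m * s < f s := fun s hs hle => by
    have h1 := hlow s hs
    rw [le_div_iff₀ (by linarith)] at hle
    nlinarith
  -- From (A - c)/(m - B) onwards the upper bound A + s B lies below the line.
  set S := max ((k - c) / (2 * m)) ((A - c) / (m - B)) with hS
  have hS0 : 0 < S := hδ.trans_le (le_max_left _ _)
  have hS1 : f S ≤ c + m * S := by
    have h1 := hup S hS0
    have h2 : (A - c) / (m - B) ≤ S := le_max_right _ _
    rw [div_le_iff₀ (by linarith)] at h2
    nlinarith
  obtain ⟨s₀, hs₀, hs₀'⟩ := intermediate_value_Icc' (le_max_left ((k - c) / (2 * m))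
    ((A - c) / (m - B))) (f := fun s => f s - (c + m * s))
    ((hcont.mono fun x hx => hδ.trans_le hx.1).sub (by fun_prop))
    (show (0 : ℝ) ∈ Icc _ _ from ⟨by linarith,
      by linarith [hsmall _ hδ le_rfl]⟩)
  have hpos : 0 < s₀ := hδ.trans_le hs₀.1
  have heq : f s₀ = c + m * s₀ := by simp only at hs₀'; linarith
  have huniq : ∀ s t, 0 < s → s < t → f s = c + m * s → f t = c + m * t → False := by
    intro s t hs hst h1 h2
    -- Two crossings s < t force N(s) > m; the tangent at s then puts f(e) below the line, although
    -- f starts above it.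
    set e := min (s / 2) ((k - c) / (2 * m)) with he
    have he0 : 0 < e := lt_min (by linarith) hδ
    have hes : e < s := (min_le_left _ _).trans_lt (by linarith)
    have h3 := hsmall e he0 (min_le_right _ _)
    have h4 := hT s e hs he0 hes.ne'
    have h5 := hT s t hs (hs.trans hst) hst.ne
    nlinarith
  refine ⟨s₀, hpos, fun s hs => ⟨fun h => ?_, fun h => h ▸ heq⟩⟩
  rcases lt_trichotomy s s₀ with h1 | h1 | h1
  · exact (huniq s s₀ hs h1 h heq).elim
  · exact h1
  · exact (huniq s₀ s hpos h1 heq h).elim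

end Tangent

/-! ### The trivial stream function and its energy integral -/

section TrivialSolution

variable {γ : ℝ → ℝ} {h lam : ℝ}

lemma IsVorticity.differentiable (hγ : IsVorticity γ) : Differentiable ℝ γ :=
  hγ.contDiff.differentiable (by norm_num)

/-- Vorticity functions are globally Lipschitz. -/
lemma IsVorticity.exists_lipschitzWith (hγ : IsVorticity γ) : ∃ K, LipschitzWith K γ := by
  obtain ⟨M, hM⟩ := hγ.bddDeriv
  refine ⟨M.toNNReal, lipschitzWith_of_nnnorm_deriv_le hγ.differentiable fun x => ?_⟩
  rw [← NNReal.coe_le_coe]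
  exact (hM x).trans (Real.le_coe_toNNReal M)

/-- The Cauchy problem for the trivial stream function is solvable. -/
lemma exists_isTrivialSol (hγ : IsVorticity γ) (hh : 0 < h) (lam : ℝ) :
    ∃ ψ, IsTrivialSol γ h lam ψ := by
  obtain ⟨K, hK⟩ := hγ.exists_lipschitzWith
  have hlip : LipschitzWith (max 1 K) fun x : ℝ × ℝ => (x.2, -γ x.1) := by
    have h1 : LipschitzWith (K * 1) fun x : ℝ × ℝ => -γ x.1 :=
      (hK.comp (LipschitzWith.prod_fst (α := ℝ) (β := ℝ))).neg
    rw [mul_one] at h1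
    exact (LipschitzWith.prod_snd (α := ℝ) (β := ℝ)).prodMk h1
  -- The data are given at the right end point, so the reflected problem is solved on [0, h] with
  -- slope -lam.
  obtain ⟨x, hx0, hx⟩ := exists_solution_of_lipschitz (f := fun _ x => (x.2, -γ x.1)) hh.le
    (fun _ _ => hlip) (fun _ => continuousOn_const) (0, -lam)
  have hm : MapsTo (fun y : ℝ => -y) (Icc (-h) 0) (Icc 0 h) := fun y hy =>
    ⟨by linarith [hy.2], by linarith [hy.1]⟩
  refine ⟨fun y => (x (-y)).1, fun y => -(x (-y)).2, ⟨fun y hy => ?_, fun y hy => ?_⟩, ?_, ?_⟩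
  · have := (hasDerivWithinAt_components (hx (-y) (hm hy))).1.comp y
      (hasDerivAt_neg y).hasDerivWithinAt hm
    exact this.congr_deriv (by simp)
  · have := ((hasDerivWithinAt_components (hx (-y) (hm hy))).2.comp y
      (hasDerivAt_neg y).hasDerivWithinAt hm).neg
    exact this.congr_deriv (by simp)
  · simp [hx0]
  · simp [hx0]

lemma isTrivialSol_trivialSol (hγ : IsVorticity γ) (hh : 0 < h) (lam : ℝ) :
    IsTrivialSol γ h lam (trivialSol γ h lam) := by
  have H := exists_isTrivialSol hγ hh lam
  rw [trivialSol, dif_pos H]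
  exact H.choose_spec

lemma hasDerivAt_gam (hγ : Continuous γ) (p : ℝ) : HasDerivAt (Gam γ) (γ (-p)) p := by
  have hc : Continuous fun s => γ (-s) := hγ.comp continuous_neg
  exact intervalIntegral.integral_hasDerivAt_right (hc.intervalIntegrable _ _)
    hc.aestronglyMeasurable.stronglyMeasurableAtFilter hc.continuousAt

lemma gam_zero : Gam γ 0 = 0 := by simp [Gam]

lemma continuous_aCoeff (hγ : Continuous γ) (lam : ℝ) : Continuous (aCoeff γ lam) := by
  have : Continuous (Gam γ) :=
    continuous_iff_continuousAt.2 fun p => (hasDerivAt_gam hγ p).continuousAt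
  unfold aCoeff
  fun_prop

/-- Conservation of energy for the trivial stream function. -/
lemma sq_deriv_trivialSol (hγ : Continuous γ) {ψ ψ' : ℝ → ℝ} (hh : 0 < h)
    (hψ : HasTwoDerivsOn (Icc (-h) 0) ψ ψ' fun y => -γ (ψ y)) (h0 : ψ 0 = 0) (h0' : ψ' 0 = lam) :
    ∀ y ∈ Icc (-h) 0, ψ' y ^ 2 = lam ^ 2 + 2 * Gam γ (-ψ y) := by
  have hz : ∀ y ∈ Icc (-h) 0,
      HasDerivWithinAt (fun y => ψ' y ^ 2 - 2 * Gam γ (-ψ y)) 0 (Icc (-h) 0) y := fun y hy => by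
    have h1 := (hψ.second y hy).pow 2
    have h2 := ((hasDerivAt_gam hγ (-ψ y)).comp_hasDerivWithinAt y (hψ.first y hy).neg).const_mul 2
    refine (h1.sub h2).congr_deriv ?_
    rw [neg_neg]
    push_cast
    ring
  have hc := eq_left_of_hasDerivWithinAt_zero hz
  intro y hy
  have h1 := (hc y hy).trans (hc 0 ⟨by linarith, le_rfl⟩).symm
  simp only [h0, h0', neg_zero, gam_zero] at h1
  linarith

lemma aCoeff_pos_of_gammaCondition (hγ : Continuous γ) (hΓ : GammaCondition γ h lam) :
    ∀ p ∈ Icc (massFlux γ h lam) 0, 0 < aCoeff γ lam p := fun p hp => by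
  have hc : Continuous (Gam γ) :=
    continuous_iff_continuousAt.2 fun p => (hasDerivAt_gam hγ p).continuousAt
  have h1 : sInf (Gam γ '' Icc (massFlux γ h lam) 0) ≤ Gam γ p :=
    csInf_le (isCompact_Icc.image hc).bddBelow (mem_image_of_mem _ hp)
  unfold GammaCondition at hΓ
  exact Real.sqrt_pos.2 (by linarith)

end TrivialSolution

/-! ### From the Sturm-Liouville problem to the dispersion function -/

section Transformation

variable {γ : ℝ → ℝ} {h g σ lam μ : ℝ} {ψ' v v' : ℝ → ℝ}

/-- Solvability of the Sturm-Liouville problem in terms of normalized solutions. -/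
lemma hasNontrivialSL_iff (hp₀ : massFlux γ h lam < 0)
    (hpos : ∀ p ∈ Icc (massFlux γ h lam) 0, 0 < aCoeff γ lam p) (hμ : μ < 0) :
    HasNontrivialSL γ h g σ μ lam ↔
      ∃ v v', IsNormalizedSL (aCoeff γ lam) (massFlux γ h lam) 0 (-μ) v v' ∧
        aCoeff γ lam 0 ^ 3 * v' 0 = g + σ * -μ := by
  constructor
  · rintro ⟨v, v', hv, hv', hbc, hl, p, hp, hvp⟩
    have hne : v 0 ≠ 0 := fun h0 => hvp
      (eq_zero_of_dirichlet (Z := fun q => aCoeff γ lam q ^ 3 * v' q)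
        (P := fun q => aCoeff γ lam q ^ 3) (Q := fun q => -μ * aCoeff γ lam q) hp₀
        (fun q hq => by
          have := (hpos q hq).ne'
          refine (hv q hq).congr_deriv ?_
          field_simp) hv' (fun q hq => pow_pos (hpos q hq) 3)
        (fun q hq => mul_nonneg (by linarith) (hpos q hq).le) hl h0 p hp).1
    refine ⟨fun q => v q / v 0, fun q => v' q / v 0, ⟨fun q hq => (hv q hq).div_const _,
      fun q hq => ?_, by simp [hl], div_self hne⟩, ?_⟩
    · have := (hv' q hq).div_const (v 0)
      simp only [mul_div_assoc] at this ⊢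
      exact this
    · rw [← mul_div_assoc, hbc, mul_div_assoc, div_self hne]
      ring
  · rintro ⟨v, v', hv, hbc⟩
    refine ⟨v, v', hv.first, hv.second, ?_, hv.left, 0, right_mem_Icc.2 hp₀.le, ?_⟩
    · rw [hbc, hv.right]
      ring
    · rw [hv.right]
      exact one_ne_zero

/-- Negative numbers are not Dirichlet eigenvalues if the trivial flow has no stagnation point. -/
lemma not_inDirichletSpectrum (hγ : IsVorticity γ) (hh : 0 < h)
    (hψ : HasTwoDerivsOn (Icc (-h) 0) (trivialSol γ h lam) ψ' fun y => -γ (trivialSol γ h lam y))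
    (hneg : ∀ y ∈ Icc (-h) 0, ψ' y < 0) (hμ : μ < 0) : ¬InDirichletSpectrum γ h lam μ := by
  rintro ⟨u, ⟨u', hu⟩, hl, hr, y, hy, huy⟩
  -- Since ψ' solves the linearized equation with μ = 0, the quotient u/ψ' satisfies (ψ'² z')' = -μ
  -- ψ'² z, whose right-hand coefficient is nonnegative.
  have := (eq_zero_of_dirichlet (z := fun y => u y / ψ' y)
    (Z := fun y => u' y * ψ' y + u y * γ (trivialSol γ h lam y)) (P := fun y => ψ' y ^ 2)
    (Q := fun y => -μ * ψ' y ^ 2) (neg_lt_zero.2 hh)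
    (fun x hx => by
      refine ((hu.first x hx).div (hψ.second x hx) (hneg x hx).ne).congr_deriv ?_
      ring)
    (fun x hx => by
      have h1 := (hγ.differentiable (trivialSol γ h lam x)).hasDerivAt.comp_hasDerivWithinAt x
        (hψ.first x hx)
      refine (((hu.second x hx).mul (hψ.second x hx)).add ((hu.first x hx).mul h1)).congr_deriv ?_
      have := (hneg x hx).ne
      simp only [Function.comp_apply]
      field_simp
      ring)
    (fun x hx => by
      have := (hneg x hx).ne
      positivity)
    (fun x _ => mul_nonneg (by linarith) (sq_nonneg _)) (by simp [hl]) (by simp [hr]) y hy).1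
  exact huy ((div_eq_zero_iff.1 this).resolve_right (hneg y hy).ne)

/-- Away from the Dirichlet spectrum, `β` is unique. -/
lemma IsBeta.eqOn {β₁ β₂ : ℝ → ℝ} (hμ : ¬InDirichletSpectrum γ h lam μ)
    (h₁ : IsBeta γ h lam μ β₁) (h₂ : IsBeta γ h lam μ β₂) : EqOn β₁ β₂ (Icc (-h) 0) := by
  obtain ⟨⟨b₁, hb₁⟩, l₁, r₁⟩ := h₁
  obtain ⟨⟨b₂, hb₂⟩, l₂, r₂⟩ := h₂
  intro y hy
  by_contra hne
  refine hμ ⟨fun x => β₁ x - β₂ x, ⟨fun x => b₁ x - b₂ x,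
    fun x hx => (hb₁.first x hx).sub (hb₂.first x hx),
    fun x hx => ((hb₁.second x hx).sub (hb₂.second x hx)).congr_deriv (by ring)⟩,
    by simp [l₁, l₂], by simp [r₁, r₂], y, hy, sub_ne_zero.2 hne⟩

/-- The semi-hodograph change of variables maps normalized solutions of the Sturm-Liouville
equation to `β`. -/
lemma IsNormalizedSL.isBeta (hγ : IsVorticity γ) (hh : 0 < h) (hlam : lam < 0)
    (hψ : HasTwoDerivsOn (Icc (-h) 0) (trivialSol γ h lam) ψ' fun y => -γ (trivialSol γ h lam y))
    (h0 : trivialSol γ h lam 0 = 0) (h0' : ψ' 0 = lam) (hneg : ∀ y ∈ Icc (-h) 0, ψ' y < 0)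
    (hv : IsNormalizedSL (aCoeff γ lam) (massFlux γ h lam) 0 (-μ) v v') :
    IsBeta γ h lam μ (fun y => ψ' y / lam * v (-trivialSol γ h lam y)) ∧
    HasDerivWithinAt (fun y => ψ' y / lam * v (-trivialSol γ h lam y))
      (-γ 0 / lam + aCoeff γ lam 0 ^ 3 * v' 0 / lam ^ 2) (Icc (-h) 0) 0 := by
  set ψ := trivialSol γ h lam with hψdef
  have hl : -h ∈ Icc (-h) 0 := left_mem_Icc.2 (by linarith)
  have hr : (0 : ℝ) ∈ Icc (-h) 0 := right_mem_Icc.2 (by linarith)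
  have hmono : MonotoneOn (fun y => -ψ y) (Icc (-h) 0) :=
    monotoneOn_Icc_of_hasDerivWithinAt (fun y hy => (hψ.first y hy).neg)
      fun y hy => by linarith [hneg y hy]
  have hmaps : MapsTo (fun y => -ψ y) (Icc (-h) 0) (Icc (massFlux γ h lam) 0) := fun y hy =>
    ⟨hmono hl hy hy.1, by simpa [h0] using hmono hy hr hy.2⟩
  have ha : ∀ y ∈ Icc (-h) 0, aCoeff γ lam (-ψ y) = -ψ' y := fun y hy => by
    rw [aCoeff, ← sq_deriv_trivialSol hγ.differentiable.continuous hh hψ h0 h0' y hy,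
      Real.sqrt_sq_eq_abs, abs_of_neg (hneg y hy)]
  -- The derivative is written through a³ v', the only combination containing v' that is known to be
  -- differentiable; a³ = -ψ'³ makes this possible.
  have hd1 : ∀ y ∈ Icc (-h) 0, HasDerivWithinAt (fun y => ψ' y / lam * v (-ψ y))
      (-γ (ψ y) / lam * v (-ψ y) +
        aCoeff γ lam (-ψ y) ^ 3 * v' (-ψ y) / (ψ' y * lam)) (Icc (-h) 0) y := fun y hy => by
    have h1 := (hv.first _ (hmaps hy)).comp y (hψ.first y hy).neg hmaps
    refine (((hψ.second y hy).div_const lam).mul h1).congr_deriv ?_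
    have h2 := (hneg y hy).ne
    have h3 := hlam.ne
    rw [ha y hy]
    simp only [Function.comp_apply, Pi.neg_apply]
    field_simp
  have hd2 : ∀ y ∈ Icc (-h) 0, HasDerivWithinAt (fun y => -γ (ψ y) / lam * v (-ψ y) +
        aCoeff γ lam (-ψ y) ^ 3 * v' (-ψ y) / (ψ' y * lam))
      (-((deriv γ (ψ y) + μ) * (ψ' y / lam * v (-ψ y)))) (Icc (-h) 0) y := fun y hy => by
    have h1 := (hv.first _ (hmaps hy)).comp y (hψ.first y hy).neg hmaps
    have h2 := (hv.second _ (hmaps hy)).comp y (hψ.first y hy).neg hmaps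
    have h3 := (hγ.differentiable (ψ y)).hasDerivAt.comp_hasDerivWithinAt y (hψ.first y hy)
    have h4 := (hneg y hy).ne
    have h5 := hlam.ne
    refine (((h3.neg.div_const lam).mul h1).add
      (h2.div ((hψ.second y hy).mul_const lam) (mul_ne_zero h4 h5))).congr_deriv ?_
    simp only [Function.comp_apply, Pi.neg_apply, ha y hy]
    field_simp
    ring
  refine ⟨⟨⟨_, hd1, hd2⟩, ?_, ?_⟩, ?_⟩
  · have : v (-ψ (-h)) = 0 := hv.left
    simp [this]
  · simp [h0, h0', hv.right, hlam.ne]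
  · refine (hd1 0 hr).congr_deriv ?_
    rw [h0, h0', neg_zero, hv.right, mul_one, ← sq]

/-- The dispersion function in terms of the flux of the normalized solution. -/
lemma IsNormalizedSL.dispersion_eq (hγ : IsVorticity γ) (hh : 0 < h) (hlam : lam < 0)
    (hψ : HasTwoDerivsOn (Icc (-h) 0) (trivialSol γ h lam) ψ' fun y => -γ (trivialSol γ h lam y))
    (h0 : trivialSol γ h lam 0 = 0) (h0' : ψ' 0 = lam) (hneg : ∀ y ∈ Icc (-h) 0, ψ' y < 0)
    (hμ : μ < 0) (hv : IsNormalizedSL (aCoeff γ lam) (massFlux γ h lam) 0 (-μ) v v') :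
    dispersion γ h g σ μ lam =
      (((aCoeff γ lam 0 ^ 3 * v' 0 - (g + σ * -μ)) / lam ^ 2 : ℝ) : EReal) := by
  have hs := not_inDirichletSpectrum hγ hh hψ hneg hμ
  obtain ⟨hβ, hd⟩ := hv.isBeta hγ hh hlam hψ h0 h0' hneg
  have H : ∃ β, IsBeta γ h lam μ β := ⟨_, hβ⟩
  have hb : IsBeta γ h lam μ (beta γ h lam μ) := by
    rw [beta, dif_pos H]
    exact H.choose_spec
  have hr : (0 : ℝ) ∈ Icc (-h) 0 := right_mem_Icc.2 (by linarith)
  have heq := hb.eqOn hs hβ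
  have hderiv := (hd.congr heq (heq hr)).derivWithin (uniqueDiffOn_Icc (by linarith) 0 hr)
  rw [dispersion, if_neg hs, hderiv]
  congr 1
  ring

lemma IsNormalizedSL.dispersion_eq_zero_iff (hγ : IsVorticity γ) (hh : 0 < h) (hlam : lam < 0)
    (hψ : HasTwoDerivsOn (Icc (-h) 0) (trivialSol γ h lam) ψ' fun y => -γ (trivialSol γ h lam y))
    (h0 : trivialSol γ h lam 0 = 0) (h0' : ψ' 0 = lam) (hneg : ∀ y ∈ Icc (-h) 0, ψ' y < 0)
    (hμ : μ < 0) (hv : IsNormalizedSL (aCoeff γ lam) (massFlux γ h lam) 0 (-μ) v v') :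
    dispersion γ h g σ μ lam = 0 ↔ aCoeff γ lam 0 ^ 3 * v' 0 = g + σ * -μ := by
  rw [hv.dispersion_eq hγ hh hlam hψ h0 h0' hneg hμ, EReal.coe_eq_zero, div_eq_zero_iff,
    sub_eq_zero, or_iff_left (pow_ne_zero 2 hlam.ne)]

/-- A strictly decreasing trivial stream function has no stagnation point. -/
lemma deriv_neg_of_strictAntiOn (hγ : IsVorticity γ) (hh : 0 < h)
    (hψ : HasTwoDerivsOn (Icc (-h) 0) (trivialSol γ h lam) ψ' fun y => -γ (trivialSol γ h lam y))
    (h0 : trivialSol γ h lam 0 = 0) (h0' : ψ' 0 = lam) (hΓ : GammaCondition γ h lam)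
    (hanti : StrictAntiOn (trivialSol γ h lam) (Icc (-h) 0)) : ∀ y ∈ Icc (-h) 0, ψ' y < 0 := by
  intro y hy
  have hlt : -h < 0 := neg_lt_zero.2 hh
  have h1 := hanti.antitoneOn.derivWithin_nonpos (x := y)
  rw [(hψ.first y hy).derivWithin (uniqueDiffOn_Icc hlt y hy)] at h1
  refine lt_of_le_of_ne h1 fun h2 => ?_
  have h3 := sq_deriv_trivialSol hγ.differentiable.continuous hh hψ h0 h0' y hy
  have hmem : -trivialSol γ h lam y ∈ Icc (massFlux γ h lam) 0 := by
    have h4 := hanti.antitoneOn (left_mem_Icc.2 hlt.le) hy hy.1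
    have h5 := hanti.antitoneOn hy (right_mem_Icc.2 hlt.le) hy.2
    rw [h0] at h5
    exact ⟨neg_le_neg h4, by linarith⟩
  have h6 := aCoeff_pos_of_gammaCondition hγ.differentiable.continuous hΓ _ hmem
  rw [aCoeff, Real.sqrt_pos, ← h3, h2] at h6
  -- A zero of ψ' would, by energy conservation, be a zero of `aCoeff`.
  norm_num at h6

end Transformation

/-! ### Estimates for large surface slope -/

section LargeSlope

variable {γ : ℝ → ℝ} {h δ C : ℝ}

/-- Sublinear growth: the vorticity is negligible against large surface slopes. -/
lemma exists_forall_growth_lt (γ₀ : ℝ) (hh : 0 < h) (hδ1 : δ < 1) (hC : 0 < C) :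
    ∃ Λ : ℝ, 0 < Λ ∧ ∀ L, Λ < L → h * (γ₀ + C * ((3 / 2 * L * h) ^ δ + 1)) < L / 2 := by
  set D := h * C * (3 / 2 * h) ^ δ with hD
  have hD0 : 0 < D := by positivity
  have hlim := tendsto_rpow_neg_atTop (sub_pos.2 hδ1)
  obtain ⟨Λ₁, h1⟩ := Filter.eventually_atTop.1
    (hlim.eventually (gt_mem_nhds (show (0 : ℝ) < 1 / (4 * D) by positivity)))
  -- The δ-power term and the constant term are each kept below L/4.
  refine ⟨max 1 (max Λ₁ (4 * (h * (γ₀ + C)))), by positivity, fun L hL => ?_⟩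
  simp only [max_lt_iff] at hL
  obtain ⟨hL1, hL2, hL3⟩ := hL
  have hL0 : 0 < L := by linarith
  have h2 := h1 L hL2.le
  have h3 : L ^ δ = L * L ^ (-(1 - δ)) := by
    calc L ^ δ = L ^ (1 + -(1 - δ)) := by
          congr 1
          ring
      _ = L * L ^ (-(1 - δ)) := by rw [Real.rpow_add hL0, Real.rpow_one]
  have h4 : (3 / 2 * L * h) ^ δ = (3 / 2 * h) ^ δ * L ^ δ := by
    rw [← Real.mul_rpow (by positivity) hL0.le]
    ring_nf
  rw [lt_div_iff₀ (by positivity)] at h2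
  have h5 : h * C * (3 / 2 * L * h) ^ δ < L / 4 := by
    rw [h4, h3]
    nlinarith
  nlinarith

/-- For large slopes at the surface the slope stays comparable to its surface value. -/
lemma slope_bounds {lam : ℝ} {ψ ψ' : ℝ → ℝ} (hlam : lam < 0)
    (hδ0 : 0 ≤ δ) (hC : 0 < C) (hgrowth : ∀ p : ℝ, 0 < p → |γ p| ≤ C * (|p| ^ δ + 1))
    (hψ : HasTwoDerivsOn (Icc (-h) 0) ψ ψ' fun y => -γ (ψ y)) (h0 : ψ 0 = 0) (h0' : ψ' 0 = lam)
    (hlarge : h * (|γ 0| + C * ((3 / 2 * -lam * h) ^ δ + 1)) < -lam / 2) :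
    ∀ y ∈ Icc (-h) 0, 3 / 2 * lam < ψ' y ∧ ψ' y < lam / 2 := by
  -- Continuation downwards from the surface: S collects the bad points. Above its greatest element
  -- y₀ the slope bounds give 0 < ψ ≤ 3|lam|h/2, where the growth hypothesis applies; the slope then
  -- changes by less than |lam|/2 down to y₀, which is thus not bad.
  set S : Set ℝ := Icc (-h) 0 ∩ ψ' ⁻¹' (Iic (3 / 2 * lam) ∪ Ici (lam / 2)) with hS
  have hcont : ContinuousOn ψ (Icc (-h) 0) := fun y hy => (hψ.first y hy).continuousWithinAt
  have hcont' : ContinuousOn ψ' (Icc (-h) 0) := fun y hy => (hψ.second y hy).continuousWithinAt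
  suffices hempty : S = ∅ by
    intro y hy
    by_contra hcon
    rw [not_and_or, not_lt, not_lt] at hcon
    exact hempty.subset (show y ∈ S from ⟨hy, hcon⟩)
  by_contra hne
  have hcompact : IsCompact S :=
    isCompact_Icc.of_isClosed_subset
      (hcont'.preimage_isClosed_of_isClosed isClosed_Icc (isClosed_Iic.union isClosed_Ici))
      inter_subset_left
  obtain ⟨y₀, ⟨hy₀, hy₀S⟩, hmax⟩ := hcompact.exists_isGreatest (nonempty_iff_ne_empty.2 hne)
  have hgood : ∀ c ∈ Ioc y₀ 0, 3 / 2 * lam < ψ' c ∧ ψ' c < lam / 2 := fun c hc => by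
    by_contra hcon
    rw [not_and_or, not_lt, not_lt] at hcon
    have : c ≤ y₀ := hmax ⟨⟨hy₀.1.trans hc.1.le, hc.2⟩, hcon⟩
    linarith [hc.1]
  have hlt : y₀ < 0 := by
    refine lt_of_le_of_ne hy₀.2 fun h1 => ?_
    rw [h1] at hy₀S
    simp only [mem_preimage, h0', mem_union, mem_Iic, mem_Ici] at hy₀S
    rcases hy₀S with h2 | h2 <;> linarith
  have hsub : ∀ y ∈ Ico y₀ 0, Icc y 0 ⊆ Icc (-h) 0 := fun y hy =>
    Icc_subset_Icc_left (hy₀.1.trans hy.1)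
  have hnhds : ∀ y ∈ Ico y₀ 0, ∀ c ∈ Ioo y 0, Icc (-h) 0 ∈ nhds c := fun y hy c hc =>
    Icc_mem_nhds (by linarith [hy₀.1, hy.1, hc.1]) hc.2
  have hγψ : ∀ y ∈ Ico y₀ 0, |γ (ψ y)| ≤ |γ 0| + C * ((3 / 2 * -lam * h) ^ δ + 1) := by
    intro y hy
    obtain ⟨c, hc, hceq⟩ := exists_hasDerivAt_eq_slope ψ ψ' hy.2 (hcont.mono (hsub y hy))
      fun c hc => (hψ.first c (hsub y hy (Ioo_subset_Icc_self hc))).hasDerivAt (hnhds y hy c hc)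
    rw [h0, eq_div_iff (by linarith [hy.2])] at hceq
    obtain ⟨hc1, hc2⟩ := hgood c ⟨hy.1.trans_lt hc.1, hc.2.le⟩
    have hy2 := hy.2
    have hyh : -y ≤ h := by linarith [hy₀.1, hy.1]
    have hpos : 0 < ψ y := by nlinarith
    have hle : ψ y ≤ 3 / 2 * -lam * h := by nlinarith
    refine (hgrowth _ hpos).trans ?_
    rw [abs_of_pos hpos]
    have := Real.rpow_le_rpow hpos.le hle hδ0
    nlinarith [abs_nonneg (γ 0)]
  have hy₀' : y₀ ∈ Ico y₀ 0 := ⟨le_rfl, hlt⟩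
  obtain ⟨c, hc, hceq⟩ := exists_hasDerivAt_eq_slope ψ' (fun y => -γ (ψ y)) hlt
    (hcont'.mono (hsub _ hy₀'))
    fun c hc => (hψ.second c (hsub _ hy₀' (Ioo_subset_Icc_self hc))).hasDerivAt (hnhds _ hy₀' c hc)
  rw [h0', eq_div_iff (by linarith)] at hceq
  have h1 := hγψ c ⟨hc.1.le, hc.2⟩
  have h2 : |lam - ψ' y₀| < -lam / 2 := by
    rw [← hceq, abs_mul, abs_neg, zero_sub, abs_neg, abs_of_neg hlt]
    refine lt_of_le_of_lt ?_ hlarge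
    rw [mul_comm]
    exact mul_le_mul (by linarith [hy₀.1]) h1 (abs_nonneg _) (by linarith [hy₀.1])
  rw [abs_lt] at h2
  rcases hy₀S with h3 | h3
  · have : ψ' y₀ ≤ 3 / 2 * lam := h3
    linarith
  · have : lam / 2 ≤ ψ' y₀ := h3
    linarith

/-- For large slopes at the surface: bounds on the slope, on the mass flux and on the
coefficient `a`. -/
lemma exists_forall_large (hγ : IsVorticity γ) (hh : 0 < h) (hδ0 : 0 ≤ δ) (hδ1 : δ < 1)
    (hC : 0 < C) (hgrowth : ∀ p : ℝ, 0 < p → |γ p| ≤ C * (|p| ^ δ + 1)) :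
    ∃ Λ : ℝ, 0 < Λ ∧ ∀ lam : ℝ, lam < 0 → Λ < |lam| →
      massFlux γ h lam < 0 ∧ 3 / 2 * lam * h ≤ massFlux γ h lam ∧ GammaCondition γ h lam ∧
      (∀ p ∈ Icc (massFlux γ h lam) 0, -lam / 2 ≤ aCoeff γ lam p) ∧
      StrictAntiOn (trivialSol γ h lam) (Icc (-h) 0) := by
  obtain ⟨Λ, hΛ, hlarge⟩ := exists_forall_growth_lt |γ 0| hh hδ1 hC
  refine ⟨Λ, hΛ, fun lam hlam hlamΛ => ?_⟩
  rw [abs_of_neg hlam] at hlamΛ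
  obtain ⟨ψ', hψ, h0, h0'⟩ := isTrivialSol_trivialSol hγ hh lam
  have hb := slope_bounds hlam hδ0 hC hgrowth hψ h0 h0' (hlarge _ hlamΛ)
  set ψ := trivialSol γ h lam with hψdef
  have hlt : -h < 0 := neg_lt_zero.2 hh
  have hcont : ContinuousOn ψ (Icc (-h) 0) := fun y hy => (hψ.first y hy).continuousWithinAt
  have hmf : massFlux γ h lam = -ψ (-h) := rfl
  obtain ⟨c, hc, hceq⟩ := exists_hasDerivAt_eq_slope ψ ψ' hlt hcont
    fun c hc => (hψ.first c (Ioo_subset_Icc_self hc)).hasDerivAt (Icc_mem_nhds hc.1 hc.2)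
  rw [h0, eq_div_iff (by linarith)] at hceq
  obtain ⟨hc1, hc2⟩ := hb c (Ioo_subset_Icc_self hc)
  have hp₀ : massFlux γ h lam < 0 := by
    rw [hmf]
    nlinarith
  -- Each such p is -ψ(y) for some y, and there the right side is ψ'(y)².
  have hsq : ∀ p ∈ Icc (massFlux γ h lam) 0, (-lam / 2) ^ 2 ≤ lam ^ 2 + 2 * Gam γ p := by
    intro p hp
    obtain ⟨y, hy, hyp⟩ := intermediate_value_Icc' hlt.le hcont
      (show -p ∈ Icc (ψ 0) (ψ (-h)) from ⟨by rw [h0]; linarith [hp.2], by linarith [hp.1]⟩)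
    have h1 := sq_deriv_trivialSol hγ.differentiable.continuous hh hψ h0 h0' y hy
    rw [hyp, neg_neg] at h1
    rw [← h1]
    nlinarith [(hb y hy).2]
  refine ⟨hp₀, by rw [hmf]; nlinarith, ?_, fun p hp => Real.le_sqrt_of_sq_le (hsq p hp), ?_⟩
  · have h1 : ((-lam / 2) ^ 2 - lam ^ 2) / 2 ≤ sInf (Gam γ '' Icc (massFlux γ h lam) 0) := by
      refine le_csInf ((nonempty_Icc.2 hp₀.le).image _) ?_
      rintro _ ⟨p, hp, rfl⟩
      linarith [hsq p hp]
    unfold GammaCondition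
    nlinarith
  · have : StrictMonoOn (fun y => -ψ y) (Icc (-h) 0) :=
      strictMonoOn_of_hasDerivWithinAt_pos (convex_Icc _ _) hcont.neg
        (fun x hx => ((hψ.first x (interior_subset hx)).mono interior_subset).neg)
        (fun x hx => by linarith [(hb x (interior_subset hx)).2])
    exact fun x hx y hy hxy => neg_lt_neg_iff.1 (this hx hy hxy)

end LargeSlope

/-! ### Counting roots through the flux function -/

variable {γ : ℝ → ℝ} {h g σ lam : ℝ}

/-- Solvability of the Sturm-Liouville problem and, in the absence of stagnation points, the
dispersion relation, in terms of the flux function. -/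
lemma hasNontrivialSL_and_dispersion_iff (hγ : IsVorticity γ) (hh : 0 < h) (hlam : lam < 0)
    (hp₀ : massFlux γ h lam < 0) (hΓ : GammaCondition γ h lam) {f : ℝ → ℝ}
    (hex : ∀ s, 0 < s → ∃ v v', IsNormalizedSL (aCoeff γ lam) (massFlux γ h lam) 0 s v v' ∧
      aCoeff γ lam 0 ^ 3 * v' 0 = f s)
    (hf : ∀ s, 0 < s → ∀ v v', IsNormalizedSL (aCoeff γ lam) (massFlux γ h lam) 0 s v v' →
      aCoeff γ lam 0 ^ 3 * v' 0 = f s) :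
    (∀ μ, μ < 0 → (HasNontrivialSL γ h g σ μ lam ↔ f (-μ) = g + σ * -μ)) ∧
    (StrictAntiOn (trivialSol γ h lam) (Set.Icc (-h) 0) →
      ∀ μ, μ < 0 → (dispersion γ h g σ μ lam = 0 ↔ f (-μ) = g + σ * -μ)) := by
  refine ⟨fun μ hμ => ?_, fun hanti μ hμ => ?_⟩
  · have hpos := aCoeff_pos_of_gammaCondition hγ.differentiable.continuous hΓ
    rw [hasNontrivialSL_iff hp₀ hpos hμ]
    constructor
    · rintro ⟨v, v', hv, hbc⟩
      rw [← hf _ (by linarith) v v' hv, hbc]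
    · intro h1
      obtain ⟨v, v', hv, hvf⟩ := hex (-μ) (by linarith)
      exact ⟨v, v', hv, hvf.trans h1⟩
  · obtain ⟨ψ', hψ, h0, h0'⟩ := isTrivialSol_trivialSol hγ hh lam
    obtain ⟨v, v', hv, hvf⟩ := hex (-μ) (by linarith)
    rw [hv.dispersion_eq_zero_iff hγ hh hlam hψ h0 h0'
      (deriv_neg_of_strictAntiOn hγ hh hψ h0 h0' hΓ hanti) hμ, hvf]

/-- For large slopes the Sturm-Liouville problem has exactly one negative eigenvalue, provided the
coefficient `a` is comparable to the slope. -/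
lemma exists_unique_flux_eq (hγ : IsVorticity γ) (hg : 0 < g) (hσ : 0 < σ)
    (hlam : lam < 0) (hlarge : max 1 (12 * h * g) < -lam)
    (hp₀ : massFlux γ h lam < 0) (hp₀' : 3 / 2 * lam * h ≤ massFlux γ h lam)
    (hΓ : GammaCondition γ h lam)
    (hle : ∀ p ∈ Set.Icc (massFlux γ h lam) 0, -lam / 2 ≤ aCoeff γ lam p) {f N : ℝ → ℝ}
    (hex : ∀ s, 0 < s → ∃ v v', IsNormalizedSL (aCoeff γ lam) (massFlux γ h lam) 0 s v v' ∧
      aCoeff γ lam 0 ^ 3 * v' 0 = f s)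
    (hT : ∀ s t, 0 < s → 0 < t → s ≠ t → f t < f s + (t - s) * N s) :
    ∃ s₀, 0 < s₀ ∧ ∀ s, 0 < s → (f s = g + σ * s ↔ s = s₀) := by
  have hpos := aCoeff_pos_of_gammaCondition hγ.differentiable.continuous hΓ
  have ha := (continuous_aCoeff hγ.differentiable.continuous lam).continuousOn
    (s := Set.Icc (massFlux γ h lam) 0)
  obtain ⟨w, w', hw, hwσ⟩ := exists_isTestFunction_weightedMass_lt hp₀ ha hσ
  rw [max_lt_iff] at hlarge
  refine existsUnique_of_tangent hT (A := dirichletEnergy (aCoeff γ lam) (massFlux γ h lam) 0 w') hσ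
    (k := (-lam / 2) ^ 3 / (0 - massFlux γ h lam)) ?_
    (fun s hs => ?_) hwσ (fun s hs => ?_)
  -- As |p₀| ≤ 3|lam|h/2, the quotient is at least lam²/(12h); this exceeds g because 12hg < |lam|
  -- and |lam| > 1.
  · rw [lt_div_iff₀ (by linarith)]
    have h1 : g * (0 - massFlux γ h lam) ≤ g * (3 / 2 * -lam * h) := by
      gcongr
      linarith
    have h2 : 12 * h * g * -lam < (-lam) ^ 2 * -lam :=
      mul_lt_mul_of_pos_right (by nlinarith) (by linarith)
    nlinarith
  · obtain ⟨v, v', hv, hvf⟩ := hex s hs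
    have ht := hv.isTestFunction ha hpos
    have h1 := ht.le_dirichletEnergy hp₀ ha (by linarith) hle
    have h2 : 0 ≤ weightedMass (aCoeff γ lam) (massFlux γ h lam) 0 v :=
      intervalIntegral.integral_nonneg hp₀.le fun p hp =>
        mul_nonneg (hpos p hp).le (sq_nonneg _)
    rw [← hvf, hv.flux_eq_energy hp₀ ha hpos]
    nlinarith
  · obtain ⟨v, v', hv, hvf⟩ := hex s hs
    rw [← hvf]
    exact hv.flux_le_energy hp₀ ha hpos hs.le hw

end WaterWave

theorem mainTheorem9
    (γ : ℝ → ℝ) (hγ : WaterWave.IsVorticity γ)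
    (h g σ : ℝ) (hh : 0 < h) (hg : 0 < g) (hσ : 0 < σ)
    (δ C : ℝ) (hδ0 : 0 ≤ δ) (hδ1 : δ < 1) (hC : 0 < C)
    (hgrowth : ∀ p : ℝ, 0 < p → |γ p| ≤ C * (|p| ^ δ + 1)) :
    -- (a)
    (∃ Λ : ℝ, 0 < Λ ∧ ∀ lam : ℝ, lam < 0 → Λ < |lam| →
      WaterWave.massFlux γ h lam < 0 ∧ WaterWave.GammaCondition γ h lam) ∧
    -- (b)
    (∀ lam : ℝ, lam < 0 → WaterWave.massFlux γ h lam < 0 → WaterWave.GammaCondition γ h lam →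
      {μ : ℝ | μ < 0 ∧ WaterWave.HasNontrivialSL γ h g σ μ lam}.encard ≤ 2 ∧
      (StrictAntiOn (WaterWave.trivialSol γ h lam) (Set.Icc (-h) 0) →
        (∀ μ : ℝ, μ < 0 →
          (WaterWave.HasNontrivialSL γ h g σ μ lam ↔ WaterWave.dispersion γ h g σ μ lam = 0)) ∧
        {μ : ℝ | μ < 0 ∧ WaterWave.dispersion γ h g σ μ lam = 0}.encard ≤ 2)) ∧
    -- (c)
    (∃ Λ : ℝ, 0 < Λ ∧ ∀ lam : ℝ, lam < 0 → Λ < |lam| →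
      ∃ μ₀ : ℝ, μ₀ < 0 ∧
        (∀ μ : ℝ, μ < 0 → (WaterWave.HasNontrivialSL γ h g σ μ lam ↔ μ = μ₀)) ∧
        (∀ μ : ℝ, μ < 0 → (WaterWave.dispersion γ h g σ μ lam = 0 ↔ μ = μ₀)) ∧
        (∀ (k₀ : ℕ) (ν : ℝ), 1 ≤ k₀ → 0 < ν → -((k₀ : ℝ) * ν) ^ 2 = μ₀ →
          ∀ k : ℕ, 1 ≤ k →
            (WaterWave.dispersion γ h g σ (-((k : ℝ) * ν) ^ 2) lam = 0 ↔ k = k₀))) := by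

  obtain ⟨Λ, hΛ, H⟩ := WaterWave.exists_forall_large hγ hh hδ0 hδ1 hC hgrowth
  refine ⟨⟨Λ, hΛ, fun lam hlam hlamΛ => ?_⟩, fun lam hlam hp₀ hΓ => ?_,
    ⟨max Λ (max 1 (12 * h * g)), lt_max_of_lt_left hΛ, fun lam hlam hlamΛ => ?_⟩⟩
  · obtain ⟨h1, -, h2, -⟩ := H lam hlam hlamΛ
    exact ⟨h1, h2⟩
  · obtain ⟨f, N, hex, hf, hT⟩ := WaterWave.exists_fluxFunction hp₀
      (WaterWave.continuous_aCoeff hγ.differentiable.continuous lam).continuousOn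
      (WaterWave.aCoeff_pos_of_gammaCondition hγ.differentiable.continuous hΓ)
    obtain ⟨h1, h2⟩ := WaterWave.hasNontrivialSL_and_dispersion_iff (g := g) (σ := σ)
      hγ hh hlam hp₀ hΓ hex hf
    exact ⟨WaterWave.encard_le_two_of_tangent hT g σ fun μ hμ => ⟨hμ.1, (h1 μ hμ.1).1 hμ.2⟩,
      fun hanti => ⟨fun μ hμ => (h1 μ hμ).trans (h2 hanti μ hμ).symm,
        WaterWave.encard_le_two_of_tangent hT g σ
          fun μ hμ => ⟨hμ.1, (h2 hanti μ hμ.1).1 hμ.2⟩⟩⟩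
  · obtain ⟨hl1, hl2⟩ := max_lt_iff.1 hlamΛ
    obtain ⟨hp₀, hp₀', hΓ, hle, hanti⟩ := H lam hlam hl1
    rw [abs_of_neg hlam] at hl2
    obtain ⟨f, N, hex, hf, hT⟩ := WaterWave.exists_fluxFunction hp₀
      (WaterWave.continuous_aCoeff hγ.differentiable.continuous lam).continuousOn
      (WaterWave.aCoeff_pos_of_gammaCondition hγ.differentiable.continuous hΓ)
    obtain ⟨h1, h2⟩ := WaterWave.hasNontrivialSL_and_dispersion_iff (g := g) (σ := σ)
      hγ hh hlam hp₀ hΓ hex hf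
    obtain ⟨s₀, hs₀, hs⟩ := WaterWave.exists_unique_flux_eq hγ hg hσ hlam hl2 hp₀ hp₀' hΓ hle
      hex hT
    have hiff : ∀ μ, μ < 0 → (f (-μ) = g + σ * -μ ↔ μ = -s₀) := fun μ hμ =>
      (hs (-μ) (by linarith)).trans neg_eq_iff_eq_neg
    have hdisp : ∀ μ, μ < 0 → (WaterWave.dispersion γ h g σ μ lam = 0 ↔ μ = -s₀) :=
      fun μ hμ => (h2 hanti μ hμ).trans (hiff μ hμ)
    refine ⟨-s₀, by linarith, fun μ hμ => (h1 μ hμ).trans (hiff μ hμ), hdisp,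
      fun k₀ ν hk₀ hν heq k hk => ?_⟩
    have hkpos : (0 : ℝ) < k := by exact_mod_cast hk
    have hk₀pos : (0 : ℝ) < k₀ := by exact_mod_cast hk₀
    rw [hdisp _ (by have := mul_pos hkpos hν; nlinarith), ← heq, neg_inj,
      sq_eq_sq₀ (by positivity) (by positivity), mul_left_inj' hν.ne', Nat.cast_inj]
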